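/- Let $(\Omega,\mathcal F,P)$ be a probability space and $d\ge 0$ an integer. Let $X=(X_s)_{s\ge 0}$ be an $\mathbb R^d$-valued process with almost surely right-continuous sample paths which are almost surely Lebesgue integrable on every bounded interval $[0,u]$, so that the integral process $Y_u=\int_0^u X_s\,ds$, $u\ge 0$, is well defined. Let $\tau=(\tau_\ell)_{\ell\ge0}$ be a stable subordinator of index $\alpha\in(0,1)$ on the same space, i.e. an almost surely right-continuous nondecreasing process with values in $[0,\infty)$, with $\tau_0=0$ a.s., with independent and stationary increments, and such that for some constant $c>0$, $E[e^{-q\tau_\ell}]=e^{-\ell c q^\alpha}$ for all $\ell,q\ge0$. The processes $X$ and $\tau$ are not required to be independent. Put $$\hat X_\ell=X_{\tau_\ell},\qquad \hat Y_\ell=Y_{\tau_\ell},\qquad \ell\ge0.$$ For a process $Z=(Z_\ell)_{\ell\ge0}$, the (augmented) right-continuous filtration generated by $Z$ is $\mathcal Z_\ell=\bigcap_{r>\ell}\big(\sigma(Z_s,\ s\le r)\vee\mathcal N\big)$, $\ell\ge 0$, where $\mathcal N$ is the collection of all $P$-negligible subsets of $\Omega$. Let $(\hat{\mathcal X}_\ell)_{\ell\ge0}$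 and $(\hat{\mathcal Y}_\ell)_{\ell\ge0}$ be the right-continuous filtrations generated in this sense by $\hat X$ and $\hat Y$. Then $$\hat{\mathcal X}_\ell\subseteq\hat{\mathcal Y}_\ell\qquad\text{for every }\ell\ge0.$$ -/

import Mathlib

open MeasureTheory ProbabilityTheory
open scoped NNReal

/-- A path indexed by `[0, ∞)` is right-continuous. -/
def RightContinuousPath {E : Type*} [TopologicalSpace E] (x : ℝ≥0 → E) : Prop :=
  ∀ t : ℝ≥0, ContinuousWithinAt x (Set.Ici t) t

/-- A subordinator: an a.s. nondecreasing, right-continuous process with values in `[0, ∞)`,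
started from `0`, with independent and stationary increments. -/
structure IsSubordinator {Ω : Type*} [MeasurableSpace Ω] (τ : ℝ≥0 → Ω → ℝ≥0)
    (P : Measure Ω) : Prop where
  measurable : ∀ t, Measurable (τ t)
  zero : ∀ᵐ ω ∂P, τ 0 ω = 0
  mono : ∀ᵐ ω ∂P, Monotone (fun t ↦ τ t ω)
  rightCont : ∀ᵐ ω ∂P, RightContinuousPath (fun t ↦ τ t ω)
  indep : HasIndepIncrements (fun t ω ↦ (τ t ω : ℝ)) P
  stationary : ∀ s t : ℝ≥0,
    IdentDistrib (fun ω ↦ (τ (s + t) ω : ℝ) - (τ s ω : ℝ)) (fun ω ↦ (τ t ω : ℝ)) P P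

/-- A stable subordinator of index `α`: its Laplace exponent is `q ↦ c * q ^ α` for some
`c > 0`, that is, `E[exp (-q τ_t)] = exp (-t c q ^ α)` for all `t, q ≥ 0`. -/
structure IsStableSubordinator {Ω : Type*} [MeasurableSpace Ω] (α : ℝ) (τ : ℝ≥0 → Ω → ℝ≥0)
    (P : Measure Ω) : Prop extends IsSubordinator τ P where
  laplace : ∃ c : ℝ, 0 < c ∧ ∀ t q : ℝ≥0,
    ∫ ω, Real.exp (-((q : ℝ) * (τ t ω : ℝ))) ∂P
      = Real.exp (-((t : ℝ) * (c * (q : ℝ) ^ α)))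

/-- The integral process `Y_u = ∫_0^u X_s ds`. -/
noncomputable def integralProcess {Ω E : Type*} [NormedAddCommGroup E] [NormedSpace ℝ E]
    (X : ℝ≥0 → Ω → E) : ℝ≥0 → Ω → E :=
  fun u ω ↦ ∫ s in (0 : ℝ)..(u : ℝ), X s.toNNReal ω

/-- The time-changed process `ℓ ↦ Z_{τ_ℓ}`. -/
def timeChange {Ω E : Type*} (Z : ℝ≥0 → Ω → E) (τ : ℝ≥0 → Ω → ℝ≥0) : ℝ≥0 → Ω → E :=
  fun l ω ↦ Z (τ l ω) ω

/-- The sigma-field `σ(Z_s, s ≤ r)` generated by a process up to time `r`. -/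
def generatedUpTo {Ω E : Type*} [MeasurableSpace E] (Z : ℝ≥0 → Ω → E) (r : ℝ≥0) :
    MeasurableSpace Ω :=
  ⨆ s ≤ r, MeasurableSpace.comap (Z s) inferInstance

/-- The right-continuous filtration generated by `Z`, augmented by the `P`-null sets:
at time `l` it is `⋂_{r > l} (σ(Z_s, s ≤ r) ∨ N)`, with `N` the `P`-negligible sets.
A set belongs to `eventuallyMeasurableSpace m (ae P)` iff it differs from a set of `m` by a
`P`-negligible set. -/
def rightContFiltration {Ω E : Type*} [MeasurableSpace Ω] [MeasurableSpace E]
    (P : Measure Ω) (Z : ℝ≥0 → Ω → E) (l : ℝ≥0) : MeasurableSpace Ω :=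
  ⨅ r > l, eventuallyMeasurableSpace (generatedUpTo Z r) (ae P)

/-! ### Averages along the squares and the law of large numbers. -/

open Filter Topology Finset

/-! Fix `s` and times `s + h n` decreasing to `s`. By right-continuity, the increments of `Ŷ` over
these gaps are asymptotic to `X̂_s` times the increments of `τ`
(`RightContinuousPath.eventually_norm_integral_sub_le`). Divided by gap^(1/α), the latter are i.i.d.
stable, so almost surely their empirical Laplace transform converges at all rational `q ≥ 0`
(`IsSubordinator.ae_tendsto_squareAverage_exp`). On that event, monotonicity in `q` allows the
random argument `X̂_s` (`tendsto_squareAverage_exp_neg_max`), whatever the dependence between `X`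
and `τ`. Inverting the transform recovers the positive and negative parts of each coordinate of
`X̂_s` from `Ŷ` just after `s`. -/

/-- The average of the first `(k + 1) ^ 2` terms of a sequence. -/
noncomputable def squareAverage (f : ℕ → ℝ) (k : ℕ) : ℝ :=
  (∑ i ∈ range ((k + 1) ^ 2), f i) / ((k : ℝ) + 1) ^ 2

theorem Filter.Tendsto.squareAverage {f : ℕ → ℝ} {a : ℝ} (hf : Tendsto f atTop (𝓝 a)) :
    Tendsto (squareAverage f) atTop (𝓝 a) := by
  have h2 : Tendsto (fun k : ℕ ↦ (k + 1) ^ 2) atTop atTop :=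
    tendsto_atTop_mono (fun k ↦ by change k ≤ (k + 1) ^ 2; nlinarith) tendsto_id
  have h := hf.cesaro.comp h2
  refine h.congr fun k ↦ ?_
  simp only [Function.comp_apply, _root_.squareAverage]
  push_cast
  rw [div_eq_inv_mul]

/-- If `f ≤ g` eventually, the limit of the averages of `f` is asymptotically a lower bound for
the averages of `g`. -/
theorem eventually_lt_squareAverage {f g : ℕ → ℝ} {a b : ℝ} (h : ∀ᶠ n in atTop, f n ≤ g n)
    (hf : Tendsto (squareAverage f) atTop (𝓝 a)) (hb : b < a) :
    ∀ᶠ k in atTop, b < squareAverage g k := by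
  -- The positive part of `f - g` dominates `f - g` and is eventually zero, so its averages vanish.
  have h0 : Tendsto (fun n ↦ max (f n - g n) 0) atTop (𝓝 0) := by
    refine tendsto_const_nhds.congr' ?_
    filter_upwards [h] with n hn
    rw [max_eq_right (by linarith)]
  have h1 := hf.sub h0.squareAverage
  rw [sub_zero] at h1
  filter_upwards [h1.eventually (lt_mem_nhds hb)] with k hk
  refine hk.trans_le ?_
  unfold squareAverage
  rw [← sub_div, ← sum_sub_distrib]
  gcongr with i
  linarith [le_max_left (f i - g i) 0]

theorem eventually_squareAverage_lt {f g : ℕ → ℝ} {a b : ℝ} (h : ∀ᶠ n in atTop, g n ≤ f n)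
    (hf : Tendsto (squareAverage f) atTop (𝓝 a)) (hb : a < b) :
    ∀ᶠ k in atTop, squareAverage g k < b := by
  have hneg (u : ℕ → ℝ) (k : ℕ) : squareAverage (fun n ↦ -u n) k = -squareAverage u k := by
    simp [squareAverage, neg_div]
  have h1 : Tendsto (squareAverage fun n ↦ -f n) atTop (𝓝 (-a)) :=
    hf.neg.congr fun k ↦ (hneg f k).symm
  filter_upwards [eventually_lt_squareAverage (h.mono fun n hn ↦ neg_le_neg hn) h1
    (neg_lt_neg hb)] with k hk
  rw [hneg] at hk
  linarith

/-- Strong law of large numbers along the squares, for bounded pairwise independent variables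
with a common mean. -/
theorem ae_tendsto_squareAverage {Ω : Type*} [MeasurableSpace Ω] {P : Measure Ω}
    [IsProbabilityMeasure P] {X : ℕ → Ω → ℝ} {m : ℝ} (hX : ∀ n, Measurable (X n))
    (h01 : ∀ n ω, X n ω ∈ Set.Icc (0 : ℝ) 1) (hind : Pairwise fun i j ↦ IndepFun (X i) (X j) P)
    (hm : ∀ n, ∫ ω, X n ω ∂P = m) :
    ∀ᵐ ω ∂P, Tendsto (squareAverage fun n ↦ X n ω) atTop (𝓝 m) := by
  have hL (n : ℕ) : MemLp (X n) 2 P :=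
    MemLp.of_bound (hX n).aestronglyMeasurable 1 (ae_of_all _ fun ω ↦ by
      rw [Real.norm_eq_abs, abs_le]; constructor <;> linarith [(h01 n ω).1, (h01 n ω).2])
  let S (k : ℕ) (ω : Ω) : ℝ := squareAverage (fun n ↦ X n ω) k
  have hSeq (k : ℕ) : S k = fun ω ↦ (((k : ℝ) + 1) ^ 2)⁻¹ *
      (∑ i ∈ range ((k + 1) ^ 2), X i) ω := by
    funext ω
    simp only [S, squareAverage, Finset.sum_apply, div_eq_inv_mul]
  have hSm (k : ℕ) : Measurable (S k) := by
    simp only [hSeq, Finset.sum_apply]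
    exact (Finset.measurable_sum _ fun i _ ↦ hX i).const_mul _
  have hSL (k : ℕ) : MemLp (S k) 2 P := by
    rw [hSeq]
    exact (memLp_finsetSum' _ fun i _ ↦ hL i).const_mul _
  have hSmean (k : ℕ) : ∫ ω, S k ω ∂P = m := by
    rw [hSeq, integral_const_mul]
    simp only [Finset.sum_apply]
    rw [integral_finsetSum _ fun i _ ↦ (hL i).integrable (by norm_num)]
    simp only [hm, sum_const, card_range, nsmul_eq_mul]
    push_cast
    field_simp
  have hvar (n : ℕ) : variance (X n) P ≤ 1 := by
    have := variance_le_sq_of_bounded (μ := P) (ae_of_all _ (h01 n)) (hX n).aemeasurable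
    norm_num at this
    linarith
  have hSvar (k : ℕ) : variance (S k) P ≤ 1 / ((k : ℝ) + 1) ^ 2 := by
    rw [hSeq, variance_const_mul, IndepFun.variance_sum (fun i _ ↦ hL i)
      (fun i _ j _ hij ↦ hind hij)]
    have h1 : ∑ i ∈ range ((k + 1) ^ 2), variance (X i) P ≤ ((k : ℝ) + 1) ^ 2 := by
      calc _ ≤ ∑ i ∈ range ((k + 1) ^ 2), (1 : ℝ) := sum_le_sum fun i _ ↦ hvar i
        _ = _ := by simp
    calc _ ≤ ((((k : ℝ) + 1) ^ 2)⁻¹) ^ 2 * ((k : ℝ) + 1) ^ 2 := by gcongr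
      _ = _ := by field_simp
  -- This is why squares are used: a variance bound `1 / N` is summable along `N = (k + 1) ^ 2`. The
  -- squared deviations then have an a.s. finite sum.
  have hsum : Summable fun k : ℕ ↦ 1 / ((k : ℝ) + 1) ^ 2 := by
    have := (summable_nat_add_iff 1).2 (Real.summable_one_div_nat_pow.2 (by norm_num : 1 < 2))
    simpa using this
  have hfin : ∫⁻ ω, ∑' k, ENNReal.ofReal ((S k ω - m) ^ 2) ∂P ≠ ⊤ := by
    rw [lintegral_tsum fun k ↦ (((hSm k).sub_const m).pow_const 2).ennreal_ofReal.aemeasurable]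
    refine ne_top_of_le_ne_top hsum.tsum_ofReal_ne_top (ENNReal.tsum_le_tsum fun k ↦ ?_)
    have := evariance_eq_lintegral_ofReal (S k) P
    rw [hSmean] at this
    rw [← this, ← (hSL k).ofReal_variance_eq]
    exact ENNReal.ofReal_le_ofReal (hSvar k)
  have hmeas : Measurable fun ω ↦ ∑' k, ENNReal.ofReal ((S k ω - m) ^ 2) :=
    Measurable.tsum fun k ↦ (((hSm k).sub_const m).pow_const 2).ennreal_ofReal
  filter_upwards [ae_lt_top hmeas hfin] with ω hω
  have h0 := ENNReal.tendsto_atTop_zero_of_tsum_ne_top hω.ne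
  have h1 : Tendsto (fun k ↦ (S k ω - m) ^ 2) atTop (𝓝 0) := by
    have := (ENNReal.tendsto_toReal ENNReal.zero_ne_top).comp h0
    refine this.congr fun k ↦ ?_
    simp [ENNReal.toReal_ofReal (sq_nonneg _)]
  have h2 : Tendsto (fun k ↦ S k ω - m) atTop (𝓝 0) := by
    rw [tendsto_zero_iff_abs_tendsto_zero]
    have := h1.sqrt
    simpa [Function.comp_def, Real.sqrt_sq_eq_abs] using this
  simpa [S] using h2.add_const m

/-! ### Laplace transforms of rescaled increments. -/

/-- If the increments `u n` are asymptotic to `x * v n` and the averages of `exp (-q * v n)`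
converge to the Laplace transform of a stable law, then the averages of `exp (-(u n)⁺)` converge to
this Laplace transform at `x⁺`. -/
theorem tendsto_squareAverage_exp_neg_max {α c x : ℝ} (hα : 0 < α) {u v : ℕ → ℝ}
    (hv : ∀ n, 0 ≤ v n) (huv : ∀ ε > 0, ∀ᶠ n in atTop, |u n - x * v n| ≤ ε * v n)
    (h : ∀ q : ℚ, 0 ≤ q → Tendsto (squareAverage fun n ↦ Real.exp (-(q * v n))) atTop
      (𝓝 (Real.exp (-(c * (q : ℝ) ^ α))))) :
    Tendsto (squareAverage fun n ↦ Real.exp (-(max (u n) 0))) atTop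
      (𝓝 (Real.exp (-(c * (max x 0) ^ α)))) := by
  have hF : Continuous fun y : ℝ ↦ Real.exp (-(c * y ^ α)) := by
    have := Real.continuous_rpow_const hα.le
    fun_prop
  refine tendsto_order.2 ⟨fun a ha ↦ ?_, fun a ha ↦ ?_⟩
  -- Lower bound: for rational `q` just above `x⁺`, eventually `(u n)⁺ ≤ q * v n`.
  · obtain ⟨δ, hδ, hball⟩ := Metric.eventually_nhds_iff.1
      (hF.continuousAt.eventually (lt_mem_nhds ha))
    obtain ⟨q, hq1, hq2⟩ := exists_rat_btwn (show max x 0 < max x 0 + δ by linarith)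
    have hq0 : (0 : ℝ) ≤ q := (le_max_right x 0).trans hq1.le
    have hxq : x < q := (le_max_left x 0).trans_lt hq1
    refine eventually_lt_squareAverage ?_ (h q (by exact_mod_cast hq0)) (hball (y := q) ?_)
    · filter_upwards [huv (q - x) (by linarith)] with n hn
      have := hv n
      have := (abs_le.1 hn).2
      gcongr
      exact max_le (by linarith) (by positivity)
    · rw [Real.dist_eq, abs_lt]; constructor <;> linarith
  -- Upper bound: `q` lies just below `x` if `x > 0`; otherwise the limit is `1` and `q = 0`
  -- suffices.
  · obtain ⟨q, hq0, hq1, hqa⟩ : ∃ q : ℚ, 0 ≤ q ∧ ((q : ℝ) < x ∨ q = 0) ∧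
        Real.exp (-(c * (q : ℝ) ^ α)) < a := by
      rcases le_or_gt x 0 with hx | hx
      · refine ⟨0, le_rfl, Or.inr rfl, ?_⟩
        rw [max_eq_right hx] at ha
        simpa using ha
      · rw [max_eq_left hx.le] at ha
        obtain ⟨δ, hδ, hball⟩ := Metric.eventually_nhds_iff.1
          (hF.continuousAt.eventually (gt_mem_nhds ha))
        obtain ⟨q, hq1, hq2⟩ := exists_rat_btwn (show max 0 (x - δ) < x by
          exact max_lt hx (by linarith))
        have hq0 : (0 : ℝ) < q := (le_max_left _ _).trans_lt hq1
        have hqδ : x - δ < q := (le_max_right _ _).trans_lt hq1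
        refine ⟨q, by exact_mod_cast hq0.le, Or.inl hq2, hball ?_⟩
        rw [Real.dist_eq, abs_lt]; constructor <;> linarith
    refine eventually_squareAverage_lt ?_ (h q hq0) hqa
    rcases hq1 with hq1 | rfl
    · filter_upwards [huv (x - q) (by linarith)] with n hn
      have := (abs_le.1 hn).1
      gcongr
      exact le_max_of_le_left (by linarith)
    · refine Eventually.of_forall fun n ↦ ?_
      gcongr
      simp

theorem HasIndepIncrements.pairwise_of_antitone {Ω : Type*} [MeasurableSpace Ω] {P : Measure Ω}
    {Z : ℝ≥0 → Ω → ℝ} (hZ : HasIndepIncrements Z P) {t : ℕ → ℝ≥0} (ht : Antitone t) :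
    Pairwise fun m n ↦ IndepFun (fun ω ↦ Z (t m) ω - Z (t (m + 1)) ω)
      (fun ω ↦ Z (t n) ω - Z (t (n + 1)) ω) P := by
  have key {m n : ℕ} (hmn : m < n) : IndepFun (fun ω ↦ Z (t n) ω - Z (t (n + 1)) ω)
      (fun ω ↦ Z (t m) ω - Z (t (m + 1)) ω) P := by
    -- The four endpoints in increasing order, then constant; the increments in question are those
    -- of index 0 and 2.
    let a : ℕ → ℝ≥0
      | 0 => t (n + 1)
      | 1 => t n
      | 2 => t (m + 1)
      | _ => t m
    have ha : Monotone a := by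
      refine monotone_nat_of_le_succ fun k ↦ ?_
      match k with
      | 0 => exact ht n.le_succ
      | 1 => exact ht hmn
      | 2 => exact ht m.le_succ
      | _ + 3 => exact le_rfl
    exact (hZ.nat ha).indepFun (by decide : (0 : ℕ) ≠ 2)
  intro m n hmn
  rcases lt_or_gt_of_ne hmn with h | h
  · exact (key h).symm
  · exact key h

/-- The rescaled increments of a stable subordinator along a decreasing sequence of times satisfy
the law of large numbers. -/
theorem IsSubordinator.ae_tendsto_squareAverage_exp {Ω : Type*} [MeasurableSpace Ω]
    {P : Measure Ω} [IsProbabilityMeasure P] {α c : ℝ} (hα : 0 < α) {τ : ℝ≥0 → Ω → ℝ≥0}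
    (hτ : IsSubordinator τ P)
    (hc : ∀ t q : ℝ≥0, ∫ ω, Real.exp (-((q : ℝ) * (τ t ω : ℝ))) ∂P
      = Real.exp (-((t : ℝ) * (c * (q : ℝ) ^ α))))
    (s : ℝ≥0) {h : ℕ → ℝ≥0} (hh : StrictAnti h) {q : ℝ} (hq : 0 ≤ q) :
    ∀ᵐ ω ∂P, Tendsto (squareAverage fun n ↦ Real.exp (-(q *
      (((h n : ℝ) - h (n + 1)) ^ (-α⁻¹) * ((τ (s + h n) ω : ℝ) - τ (s + h (n + 1)) ω)))))
      atTop (𝓝 (Real.exp (-(c * q ^ α)))) := by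
  have hg (n : ℕ) : 0 < (h n : ℝ) - h (n + 1) := sub_pos.2 (NNReal.coe_lt_coe.2 (hh n.lt_succ_self))
  -- Truncating at 0 bounds `φ n` by 1 everywhere, since `τ` is monotone only almost surely.
  let φ (n : ℕ) (y : ℝ) : ℝ := Real.exp (-(q * (((h n : ℝ) - h (n + 1)) ^ (-α⁻¹) * max y 0)))
  have hφ (n : ℕ) : Measurable (φ n) := by fun_prop
  let D (n : ℕ) (ω : Ω) : ℝ := (τ (s + h n) ω : ℝ) - τ (s + h (n + 1)) ω
  have hτm (t : ℝ≥0) : Measurable fun ω ↦ (τ t ω : ℝ) := (hτ.measurable t).coe_nnreal_real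
  have hD (n : ℕ) : Measurable (D n) := (hτm _).sub (hτm _)
  have hind : Pairwise fun m n ↦ IndepFun (φ m ∘ D m) (φ n ∘ D n) P := fun m n hmn ↦
    (HasIndepIncrements.pairwise_of_antitone hτ.indep (t := fun n ↦ s + h n)
      (fun a b hab ↦ add_le_add_right (hh.antitone hab) s) hmn).comp (hφ m) (hφ n)
  have hmean (n : ℕ) : ∫ ω, (φ n ∘ D n) ω ∂P = Real.exp (-(c * q ^ α)) := by
    let g : ℝ≥0 := h n - h (n + 1)
    have hgc : (g : ℝ) = (h n : ℝ) - h (n + 1) := NNReal.coe_sub (hh n.lt_succ_self).le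
    have hst := hτ.stationary (s + h (n + 1)) g
    have hadd : s + h (n + 1) + g = s + h n := by
      rw [add_assoc, add_tsub_cancel_of_le (hh n.lt_succ_self).le]
    rw [hadd] at hst
    have h1 : ∫ ω, (φ n ∘ D n) ω ∂P = ∫ ω, φ n (τ g ω) ∂P := (hst.comp (hφ n)).integral_eq
    obtain ⟨q', hq'⟩ : ∃ q' : ℝ≥0, (q' : ℝ) = q * (g : ℝ) ^ (-α⁻¹) :=
      ⟨_, Real.coe_toNNReal _ (by positivity)⟩
    have h2 : ∫ ω, φ n (τ g ω) ∂P = ∫ ω, Real.exp (-((q' : ℝ) * (τ g ω : ℝ))) ∂P := by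
      refine integral_congr_ae (ae_of_all _ fun ω ↦ ?_)
      have : max (τ g ω : ℝ) 0 = τ g ω := max_eq_left (τ g ω).coe_nonneg
      simp only [φ, this, ← hgc, hq', mul_assoc]
    have hg0 : (0 : ℝ) < g := hgc ▸ hg n
    -- The factor `(g ^ (-α⁻¹)) ^ α = g⁻¹` cancels the time `g`, so the mean does not depend on `n`.
    rw [h1, h2, hc, hq', Real.mul_rpow hq (by positivity), ← Real.rpow_mul hg0.le, neg_mul,
      inv_mul_cancel₀ hα.ne', Real.rpow_neg_one]
    congr 2
    field_simp
  have hlln := ae_tendsto_squareAverage (fun n ↦ (hφ n).comp (hD n))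
    (fun n ω ↦ ⟨(Real.exp_pos _).le, Real.exp_le_one_iff.2 (neg_nonpos.2 (mul_nonneg hq
      (mul_nonneg (Real.rpow_nonneg (hg n).le _) (le_max_right _ _))))⟩) hind hmean
  filter_upwards [hlln, hτ.mono] with ω hω hmono
  have hD0 (n : ℕ) : max (D n ω) 0 = D n ω := max_eq_left (sub_nonneg.2 (NNReal.coe_le_coe.2
    (hmono (add_le_add_right (hh n.lt_succ_self).le s))))
  simpa only [Function.comp_apply, φ, hD0] using hω

/-! ### Local behaviour of the integral process. -/

/-- A right-continuous path is asymptotically constant for its integral process. -/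
theorem RightContinuousPath.eventually_norm_integral_sub_le {E : Type*} [NormedAddCommGroup E]
    [NormedSpace ℝ E] [CompleteSpace E] {x : ℝ≥0 → E} (hx : RightContinuousPath x)
    (hint : ∀ u : ℝ≥0, IntervalIntegrable (fun s : ℝ ↦ x s.toNNReal) volume 0 (u : ℝ))
    (t : ℝ≥0) {ε : ℝ} (hε : 0 < ε) :
    ∀ᶠ b in 𝓝[≥] t, ∀ a, t ≤ a → a ≤ b →
      ‖(∫ s in (0 : ℝ)..b, x s.toNNReal) - (∫ s in (0 : ℝ)..a, x s.toNNReal)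
        - ((b : ℝ) - a) • x t‖ ≤ ε * ((b : ℝ) - a) := by
  have h1 : ∀ᶠ u in 𝓝[≥] t, dist (x u) (x t) < ε :=
    (hx t).eventually (Metric.ball_mem_nhds _ hε)
  obtain ⟨δ, hδ, hball⟩ := Metric.mem_nhdsWithin_iff.1 h1
  have h2 : ∀ᶠ b in 𝓝[≥] t, b ∈ Metric.ball t δ :=
    mem_nhdsWithin_of_mem_nhds (Metric.ball_mem_nhds _ hδ)
  filter_upwards [h2] with b hb a hta hab
  have hab' : (a : ℝ) ≤ b := NNReal.coe_le_coe.2 hab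
  have hi : IntervalIntegrable (fun s : ℝ ↦ x s.toNNReal) volume a b := (hint a).symm.trans (hint b)
  rw [intervalIntegral.integral_interval_sub_left (hint b) (hint a),
    ← intervalIntegral.integral_const, ← intervalIntegral.integral_sub hi (by simp),
    ← abs_of_nonneg (sub_nonneg.2 hab')]
  refine intervalIntegral.norm_integral_le_of_norm_le_const fun u hu ↦ ?_
  rw [Set.uIoc_of_le hab'] at hu
  rw [← dist_eq_norm]
  have hu0 : 0 ≤ u := a.coe_nonneg.trans hu.1.le
  have htu : (t : ℝ) ≤ u := (NNReal.coe_le_coe.2 hta).trans hu.1.le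
  refine (hball ⟨?_, ?_⟩ : dist (x u.toNNReal) (x t) < ε).le
  · rw [Metric.mem_ball, NNReal.dist_eq, Real.coe_toNNReal _ hu0, abs_of_nonneg (sub_nonneg.2 htu)]
    rw [Metric.mem_ball, NNReal.dist_eq] at hb
    linarith [le_abs_self ((b : ℝ) - t), hu.2]
  · exact (Real.le_toNNReal_iff_coe_le hu0).2 htu

/-! ### Recovering the time-changed process. -/

theorem measurable_generatedUpTo {Ω E : Type*} [MeasurableSpace E] (Z : ℝ≥0 → Ω → E)
    {t r : ℝ≥0} (htr : t ≤ r) : Measurable[generatedUpTo Z r] (Z t) :=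
  Measurable.mono (comap_measurable (Z t))
    (le_iSup₂ (f := fun s (_ : s ≤ r) ↦ MeasurableSpace.comap (Z s) inferInstance) t htr) le_rfl

/-- The limsup is measurable for `m` even where the sequence diverges. -/
theorem exists_measurable_ae_tendsto {Ω : Type*} [MeasurableSpace Ω] {P : Measure Ω}
    {m : MeasurableSpace Ω} {f : ℕ → Ω → ℝ} (hf : ∀ n, Measurable[m] (f n)) {g : Ω → ℝ}
    (h : ∀ᵐ ω ∂P, Tendsto (fun n ↦ f n ω) atTop (𝓝 (g ω))) :
    ∃ g' : Ω → ℝ, Measurable[m] g' ∧ g =ᵐ[P] g' :=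
  ⟨fun ω ↦ limsup (fun n ↦ f n ω) atTop, Measurable.limsup hf,
    h.mono fun _ hω ↦ hω.limsup_eq.symm⟩

/-- Each coordinate of the time-changed process is a.s. a function of the increments of the
time-changed integral process just after the current time. -/
theorem IsStableSubordinator.exists_measurable_ae_eq_timeChange {Ω : Type*} [MeasurableSpace Ω]
    {P : Measure Ω} [IsProbabilityMeasure P] {d : ℕ} {α : ℝ} (hα : 0 < α)
    {X : ℝ≥0 → Ω → EuclideanSpace ℝ (Fin d)}
    (hXcont : ∀ᵐ ω ∂P, RightContinuousPath (fun s ↦ X s ω))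
    (hXint : ∀ᵐ ω ∂P, ∀ u : ℝ≥0,
      IntervalIntegrable (fun s : ℝ ↦ X s.toNNReal ω) volume 0 (u : ℝ))
    {τ : ℝ≥0 → Ω → ℝ≥0} (hτ : IsStableSubordinator α τ P) {s r : ℝ≥0} (hsr : s < r) (j : Fin d) :
    ∃ g : Ω → ℝ, Measurable[generatedUpTo (timeChange (integralProcess X) τ) r] g ∧
      (fun ω ↦ timeChange X τ s ω j) =ᵐ[P] g := by
  obtain ⟨c, hc0, hc⟩ := hτ.laplace
  let h (n : ℕ) : ℝ≥0 := (r - s) * (1 / 2) ^ n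
  have hrs : 0 < r - s := tsub_pos_of_lt hsr
  have hh : StrictAnti h := fun m n hmn ↦
    mul_lt_mul_of_pos_left (pow_lt_pow_right_of_lt_one₀ (by norm_num)
      (NNReal.half_lt_self one_ne_zero) hmn) hrs
  have hh0 : Tendsto h atTop (𝓝 0) := by
    have := (NNReal.tendsto_pow_atTop_nhds_zero_of_lt_one
      (NNReal.half_lt_self one_ne_zero)).const_mul (r - s)
    simpa [h] using this
  have hhr (n : ℕ) : s + h n ≤ r := by
    have h1 : h n ≤ r - s := mul_le_of_le_one_right' (pow_le_one₀ (by simp)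
      (NNReal.half_lt_self one_ne_zero).le)
    calc s + h n ≤ s + (r - s) := by gcongr
      _ = r := add_tsub_cancel_of_le hsr.le
  let w (n : ℕ) : ℝ := ((h n : ℝ) - h (n + 1)) ^ (-α⁻¹)
  have hw (n : ℕ) : 0 ≤ w n :=
    Real.rpow_nonneg (sub_nonneg.2 (NNReal.coe_le_coe.2 (hh n.lt_succ_self).le)) _
  let Y := timeChange (integralProcess X) τ
  let u (n : ℕ) (ω : Ω) : ℝ := w n * (Y (s + h n) ω j - Y (s + h (n + 1)) ω j)
  -- The values `σ = 1` and `σ = -1` give the positive and negative parts.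
  let A (σ : ℝ) (k : ℕ) (ω : Ω) : ℝ := squareAverage (fun n ↦ Real.exp (-(max (σ * u n ω) 0))) k
  have hYm (n : ℕ) : Measurable[generatedUpTo Y r] fun ω ↦ Y (s + h n) ω j := by
    have h1 : Measurable fun y : EuclideanSpace ℝ (Fin d) ↦ y j := by fun_prop
    exact h1.comp (measurable_generatedUpTo Y (hhr n))
  have hum (n : ℕ) : Measurable[generatedUpTo Y r] (u n) := ((hYm n).sub (hYm (n + 1))).const_mul _
  have hAm (σ : ℝ) (k : ℕ) : Measurable[generatedUpTo Y r] (A σ k) := by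
    let _ := generatedUpTo Y r
    exact (Finset.measurable_sum _ fun n _ ↦
      Real.measurable_exp.comp (((hum n).const_mul σ).max measurable_const).neg).div_const _
  have hlim (σ : ℝ) : ∀ᵐ ω ∂P, Tendsto (fun k ↦ A σ k ω) atTop
      (𝓝 (Real.exp (-(c * (max (σ * timeChange X τ s ω j) 0) ^ α)))) := by
    -- Only countably many `q`, hence a single null set, chosen before the random slope enters.
    have hlln : ∀ᵐ ω ∂P, ∀ q : ℚ, 0 ≤ q → Tendsto (squareAverage fun n ↦ Real.exp (-(q *
        (w n * ((τ (s + h n) ω : ℝ) - τ (s + h (n + 1)) ω))))) atTop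
        (𝓝 (Real.exp (-(c * (q : ℝ) ^ α)))) := ae_all_iff.2 fun q ↦ ae_all_iff.2 fun hq ↦
      hτ.toIsSubordinator.ae_tendsto_squareAverage_exp hα hc s hh
        (q := q) (by exact_mod_cast hq)
    filter_upwards [hlln, hτ.mono, hτ.rightCont, hXcont, hXint] with ω hω hmono hτr hXr hXi
    have hΔ (n : ℕ) : 0 ≤ (τ (s + h n) ω : ℝ) - τ (s + h (n + 1)) ω := sub_nonneg.2
      (NNReal.coe_le_coe.2 (hmono (add_le_add_right (hh n.lt_succ_self).le s)))
    refine tendsto_squareAverage_exp_neg_max hα (fun n ↦ mul_nonneg (hw n) (hΔ n)) ?_ hω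
    intro ε hε
    have htime : Tendsto (fun n ↦ τ (s + h n) ω) atTop (𝓝[≥] (τ s ω)) := by
      refine tendsto_nhdsWithin_iff.2 ⟨?_, Eventually.of_forall fun n ↦ hmono le_self_add⟩
      refine (hτr s).tendsto.comp (tendsto_nhdsWithin_iff.2
        ⟨?_, Eventually.of_forall fun n ↦ Set.mem_Ici.2 le_self_add⟩)
      simpa using hh0.const_add s
    have hη : 0 < ε / (|σ| + 1) := by positivity
    filter_upwards [htime.eventually (hXr.eventually_norm_integral_sub_le hXi (τ s ω) hη)] with n hn
    have h1 := (PiLp.norm_apply_le _ j).trans (hn (τ (s + h (n + 1)) ω) (hmono le_self_add)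
      (hmono (add_le_add_right (hh n.lt_succ_self).le s)))
    rw [Real.norm_eq_abs] at h1
    simp only [PiLp.sub_apply, PiLp.smul_apply, smul_eq_mul] at h1
    set Δ := (τ (s + h n) ω : ℝ) - τ (s + h (n + 1)) ω
    have h2 : |Y (s + h n) ω j - Y (s + h (n + 1)) ω j - Δ * timeChange X τ s ω j|
      ≤ ε / (|σ| + 1) * Δ := h1
    calc _ = |σ| * (w n * |Y (s + h n) ω j - Y (s + h (n + 1)) ω j
            - Δ * timeChange X τ s ω j|) := by
          conv_rhs => rw [← abs_of_nonneg (hw n), ← abs_mul, ← abs_mul]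
          congr 1
          simp only [u, w]
          ring
      _ ≤ (|σ| + 1) * (w n * (ε / (|σ| + 1) * Δ)) := by
          have := hw n
          gcongr
          linarith
      _ = ε * (w n * Δ) := by field_simp
  have hinv (y : ℝ) (hy : 0 ≤ y) : (-Real.log (Real.exp (-(c * y ^ α))) / c) ^ α⁻¹ = y := by
    rw [Real.log_exp, neg_neg, mul_div_cancel_left₀ _ hc0.ne', Real.rpow_rpow_inv hy hα.ne']
  obtain ⟨g₁, hg₁, he₁⟩ := exists_measurable_ae_tendsto (hAm 1) (hlim 1)
  obtain ⟨g₂, hg₂, he₂⟩ := exists_measurable_ae_tendsto (hAm (-1)) (hlim (-1))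
  have hψ : Measurable fun y : ℝ ↦ (-Real.log y / c) ^ α⁻¹ := by fun_prop
  refine ⟨fun ω ↦ (-Real.log (g₁ ω) / c) ^ α⁻¹ - (-Real.log (g₂ ω) / c) ^ α⁻¹,
    (hψ.comp hg₁).sub (hψ.comp hg₂), ?_⟩
  filter_upwards [he₁, he₂] with ω h₁ h₂
  rw [← h₁, ← h₂, hinv _ (le_max_right _ _), hinv _ (le_max_right _ _), one_mul, neg_one_mul]
  exact (max_zero_sub_max_neg_zero_eq_self _).symm

theorem eventuallyMeasurableSpace_le {Ω : Type*} {m m' : MeasurableSpace Ω} {l : Filter Ω}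
    [CountableInterFilter l] (h : m ≤ eventuallyMeasurableSpace m' l) :
    eventuallyMeasurableSpace m l ≤ eventuallyMeasurableSpace m' l :=
  fun _ ⟨_, ht, hst⟩ ↦ EventuallyMeasurableSet.congr (h _ ht) hst

theorem theorem1 {Ω : Type*} [MeasurableSpace Ω] (P : Measure Ω) [IsProbabilityMeasure P]
    (d : ℕ) (α : ℝ) (hα0 : 0 < α) (hα1 : α < 1)
    (X : ℝ≥0 → Ω → EuclideanSpace ℝ (Fin d))
    (hXmeas : ∀ s, Measurable (X s))
    (hXcont : ∀ᵐ ω ∂P, RightContinuousPath (fun s ↦ X s ω))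
    (hXint : ∀ᵐ ω ∂P, ∀ u : ℝ≥0,
      IntervalIntegrable (fun s : ℝ ↦ X s.toNNReal ω) volume 0 (u : ℝ))
    (τ : ℝ≥0 → Ω → ℝ≥0) (hτ : IsStableSubordinator α τ P) :
    ∀ l : ℝ≥0, rightContFiltration P (timeChange X τ) l
      ≤ rightContFiltration P (timeChange (integralProcess X) τ) l := by
  intro l
  refine le_iInf₂ fun r hr ↦ ?_
  -- The gap between `r'` and `r` leaves room for the increments of `Ŷ` after each `s ≤ r'`.
  obtain ⟨r', hlr', hr'⟩ := exists_between hr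
  refine (iInf₂_le r' hlr').trans (eventuallyMeasurableSpace_le (iSup₂_le fun s hs ↦ ?_))
  choose g hg hXg using fun j ↦
    hτ.exists_measurable_ae_eq_timeChange hα0 hXcont hXint (hs.trans_lt hr') j
  rw [← measurable_iff_comap_le]
  have hG : Measurable[generatedUpTo (timeChange (integralProcess X) τ) r]
      fun ω ↦ WithLp.toLp 2 fun j ↦ g j ω :=
    (WithLp.measurable_toLp 2 _).comp (@measurable_pi_lambda _ _ _ (_) _ _ hg)
  refine @Measurable.eventuallyMeasurable_of_eventuallyEq _ (_) _ _ _ _ _ _ hG ?_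
  filter_upwards [ae_all_iff.2 hXg] with ω hω
  ext j
  exact hω j
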